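/- Let $\Gamma$ be a surface group, i.e. a group isomorphic to the fundamental group $\langle a_1,b_1,\dots,a_g,b_g \mid [a_1,b_1]\cdots[a_g,b_g]=1\rangle$ of a closed oriented surface of genus $g\ge 2$. Let $V=\mathbb{R}^3$ with canonical basis $(e_1,e_2,e_3)$, let $L_0\subset P(V)$ be the projective line of the plane spanned by $e_1$ and $e_3$, and let $A_{can}=P(V)\setminus(L_0\cup\{[e_2]\})$, with the topology induced by $P(V)$. The group $\mathrm{GL}_2=\mathrm{GL}(2,\mathbb{R})$ acts linearly on $V$ by $$\begin{pmatrix} a&b\\c&d\end{pmatrix}\longmapsto\begin{pmatrix} a&0&b\\0&1&0\\c&0&d\end{pmatrix},$$ and hence projectively on $A_{can}$. Let $\lambda_1,\lambda_2:\Gamma\to\mathrm{GL}_2$ be two injective homomorphisms with discrete image. Then the following are equivalent: (i) the two actions of $\Gamma$ on $A_{can}$ through $\lambda_1$ and $\lambda_2$ are topologically conjugate, i.e. there is a homeomorphism $f:A_{can}\to A_{can}$ with $f(\lambda_1(\gamma)\,p)=\lambda_2(\gamma)\,f(p)$ for all $\gamma\in\Gamma$ and $p\in A_{can}$; (ii)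 $\lambda_1$ and $\lambda_2$ are conjugate in $\mathrm{GL}_2$, i.e. there is $h\in\mathrm{GL}_2$ with $\lambda_2(\gamma)=h\,\lambda_1(\gamma)\,h^{-1}$ for all $\gamma\in\Gamma$. -/

import Mathlib

open scoped LinearAlgebra.Projectivization MatrixGroups

namespace SurfaceRigidity

/-- The word `[a₁, b₁] ⋯ [a_g, b_g]` in the free group on `a₁, …, a_g, b₁, …, b_g`. -/
def surfaceRelator (g : ℕ) : FreeGroup (Fin g ⊕ Fin g) :=
  (List.ofFn fun i : Fin g =>
    FreeGroup.of (Sum.inl i) * FreeGroup.of (Sum.inr i) *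
      (FreeGroup.of (Sum.inl i))⁻¹ * (FreeGroup.of (Sum.inr i))⁻¹).prod

/-- `⟨a₁, b₁, …, a_g, b_g | [a₁, b₁] ⋯ [a_g, b_g] = 1⟩`, the fundamental group of the closed
oriented surface of genus `g`. -/
abbrev GenusGroup (g : ℕ) : Type :=
  PresentedGroup ({surfaceRelator g} : Set (FreeGroup (Fin g ⊕ Fin g)))

/-- A surface group: a group isomorphic to the fundamental group of a closed oriented surface
of genus at least two (equivalently, of negative Euler characteristic `2 - 2 g`). -/
def IsSurfaceGroup (Γ : Type*) [Group Γ] : Prop :=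
  ∃ g : ℕ, 2 ≤ g ∧ Nonempty (Γ ≃* GenusGroup g)

/-- A discrete and faithful representation into `GL₂(ℝ)`. -/
def IsDiscreteFaithful {Γ : Type*} [Group Γ] (l : Γ →* GL (Fin 2) ℝ) : Prop :=
  Function.Injective l ∧ DiscreteTopology l.range

/-- The vector space `V = ℝ³`; its canonical basis `(e₁, e₂, e₃)` is indexed by `0, 1, 2`. -/
abbrev V : Type := Fin 3 → ℝ

/-- The usual topology of `P(V)`: the quotient topology from `V ∖ {0}`. -/
noncomputable instance projTopology : TopologicalSpace (ℙ ℝ V) :=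
  TopologicalSpace.coinduced (Projectivization.mk' ℝ : {v : V // v ≠ 0} → ℙ ℝ V) inferInstance

/-- The point `[e₂]` of `P(V)`. -/
noncomputable def ptE2 : ℙ ℝ V :=
  Projectivization.mk ℝ (Pi.single 1 1 : V) (by simp)

/-- The projective line `L₀ = [ker e₂*]`. -/
def lineL0 : Set (ℙ ℝ V) :=
  {p | p.submodule ≤ LinearMap.ker (LinearMap.proj 1 : V →ₗ[ℝ] ℝ)}

/-- The annulus `A_can = P(V) ∖ (L₀ ∪ {[e₂]})`. -/
def annulus : Set (ℙ ℝ V) :=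
  (lineL0 ∪ {ptE2})ᶜ

/-- The `3 × 3` matrix of the linear map acting by `A` on `ℝ e₁ ⊕ ℝ e₃` and fixing `e₂`. -/
def blockMatrix (A : Matrix (Fin 2) (Fin 2) ℝ) : Matrix (Fin 3) (Fin 3) ℝ :=
  !![A 0 0, 0, A 0 1; 0, 1, 0; A 1 0, 0, A 1 1]

/-- `blockMatrix` is multiplicative. -/
def blockHom : Matrix (Fin 2) (Fin 2) ℝ →* Matrix (Fin 3) (Fin 3) ℝ where
  toFun := blockMatrix
  map_one' := by
    ext i j
    fin_cases i <;> fin_cases j <;> simp [blockMatrix]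
  map_mul' A B := by
    ext i j
    fin_cases i <;> fin_cases j <;>
      simp [blockMatrix, Matrix.mul_apply, Fin.sum_univ_succ]

/-- The embedding of `GL₂` in `GL(V)`; followed by `GL(V) → PGL(V)` it identifies `GL₂` with the
stabilizer of `[e₂]` and `L₀`. -/
def embGL : GL (Fin 2) ℝ →* GL (Fin 3) ℝ :=
  Units.map blockHom

theorem embGL_smul (g : GL (Fin 2) ℝ) (v : V) :
    embGL g • v = ![g 0 0 * v 0 + g 0 1 * v 2, v 1, g 1 0 * v 0 + g 1 1 * v 2] := by
  change Matrix.mulVec (blockMatrix (g : Matrix (Fin 2) (Fin 2) ℝ)) v = _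
  ext i
  fin_cases i <;> simp [blockMatrix, Matrix.mulVec, dotProduct, Fin.sum_univ_succ]

theorem mk_mem_lineL0 {v : V} (hv : v ≠ 0) : Projectivization.mk ℝ v hv ∈ lineL0 ↔ v 1 = 0 := by
  simp [lineL0, Projectivization.submodule_mk, Submodule.span_singleton_le_iff_mem]

theorem embGL_smul_mem_lineL0 (g : GL (Fin 2) ℝ) (p : ℙ ℝ V) :
    embGL g • p ∈ lineL0 ↔ p ∈ lineL0 := by
  induction p with
  | h v hv =>
    rw [Projectivization.smul_mk, mk_mem_lineL0, mk_mem_lineL0, embGL_smul]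
    simp

theorem embGL_smul_ptE2 (g : GL (Fin 2) ℝ) : embGL g • ptE2 = ptE2 := by
  have h : embGL g • (Pi.single 1 1 : V) = Pi.single 1 1 := by
    rw [embGL_smul]
    ext i
    fin_cases i <;> simp
  simp only [ptE2, Projectivization.smul_mk, h]

theorem embGL_smul_mem_annulus (g : GL (Fin 2) ℝ) {p : ℙ ℝ V} (hp : p ∈ annulus) :
    embGL g • p ∈ annulus := by
  intro h
  apply hp
  rcases h with h | h
  · exact Or.inl ((embGL_smul_mem_lineL0 g p).1 h)
  · right
    have h1 : embGL g • p = embGL g • ptE2 := by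
      rw [embGL_smul_ptE2]
      exact h
    exact MulAction.injective (embGL g) h1

/-- The projective action of `GL₂` on the annulus `A_can`. -/
noncomputable instance annulusAction : MulAction (GL (Fin 2) ℝ) annulus where
  smul g p := ⟨embGL g • (p : ℙ ℝ V), embGL_smul_mem_annulus g p.2⟩
  one_smul p := Subtype.ext (by
    change embGL 1 • (p : ℙ ℝ V) = p
    rw [map_one, one_smul])
  mul_smul g h p := Subtype.ext (by
    change embGL (g * h) • (p : ℙ ℝ V) = embGL g • (embGL h • (p : ℙ ℝ V))
    rw [map_mul, mul_smul])

/-- The actions of `Γ` on `A_can` through `l₁` and `l₂` are topologically conjugate. -/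
def ConjugateActions {Γ : Type*} [Group Γ] (l₁ l₂ : Γ →* GL (Fin 2) ℝ) : Prop :=
  ∃ f : annulus ≃ₜ annulus, ∀ (γ : Γ) (p : annulus), f (l₁ γ • p) = l₂ γ • f p

/-- The representations `l₁` and `l₂` are conjugate in `GL₂`. -/
def ConjugateReps {Γ : Type*} [Group Γ] (l₁ l₂ : Γ →* GL (Fin 2) ℝ) : Prop :=
  ∃ h : GL (Fin 2) ℝ, ∀ γ : Γ, l₂ γ = h * l₁ γ * h⁻¹

end SurfaceRigidity

/-!
Affine coordinates identify the annulus equivariantly with the punctured plane `ℝ² ∖ {0}`, so the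
question is about a homeomorphism `F` of the latter intertwining `l₁` and `l₂`. Hyperbolicity of a
matrix of determinant one is visible topologically: it means that no forward orbit stays in a
compact set. As the range of `l₁` is not solvable, its commutator subgroup contains a hyperbolic
`l₁ x`; then `l₂ x` is hyperbolic too, and after conjugation `l₁ x = diag(μ, μ⁻¹)` and
`l₂ x = diag(ν, ν⁻¹)` with `|μ|, |ν| > 1`.

On the first axis the conjugates `xⁿ γ x⁻ⁿ` converge to scaling by the entry `γ₀₀`. Hence `F`
maps this axis to itself and turns scaling by `(l₁ γ)₀₀` into scaling by `(l₂ γ)₀₀`. The pairs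
of scalings that `F` intertwines form a closed subgroup `P` of `ℝˣ × ℝˣ` which meets both factors
trivially. Comparing the entries of `y`, `xⁿ`, `z` and `y xⁿ z` shows that `P` contains the pairs
`(1 + a μ⁻²ⁿ, 1 + b ν⁻²ⁿ)` for large `n`, where `a ≠ 0`. Such small elements force a closed
subgroup to contain a line, which can only be the diagonal because `(μ, ν)` lies in `P` as well.
So `P` lies in the diagonal, `l₁` and `l₂` have the same `(0, 0)` entries, and these determine an
irreducible representation up to conjugation.
-/

namespace SurfaceRigidity

open Filter Topology
open scoped commutatorElement

section Solvability

theorem isSolvable_of_isSolvable_commutator {G : Type*} [Group G]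
    (h : Group.IsSolvable (commutator G)) : Group.IsSolvable G :=
  Group.isSolvable_of_ker_le_range (commutator G).subtype Abelianization.of
    (by rw [Abelianization.ker_of, Subgroup.range_subtype])

theorem isSolvable_of_isSolvable_map {G H : Type*} [Group G] [Group H] {f : G →* H}
    (hf : Function.Injective f) {K : Subgroup G} (_ : Group.IsSolvable (K.map f)) :
    Group.IsSolvable K :=
  Group.isSolvable_of_isSolvable_injective (f := (K.equivMapOfInjective f hf).toMonoidHom)
    (MulEquiv.injective _)

theorem isSolvable_of_isSolvable_bracket {G : Type*} [Group G] {K : Subgroup G}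
    (hK : Group.IsSolvable ↥⁅K, K⁆) : Group.IsSolvable K := by
  rw [← Subgroup.map_subtype_commutator] at hK
  exact isSolvable_of_isSolvable_commutator
    (isSolvable_of_isSolvable_map K.subtype_injective hK)

theorem commutator_le_stabilizer_of_smul_eq_or_eq {G α : Type*} [Group G] [MulAction G α]
    {p q : α} (h : ∀ g : G, g • p = p ∨ g • p = q) :
    commutator G ≤ MulAction.stabilizer G p := by
  by_cases hfix : ∀ g : G, g • p = p
  · exact fun g _ ↦ hfix g
  obtain ⟨g₀, hg₀⟩ := not_forall.1 hfix
  have horbit : MulAction.orbit G p = {p, q} := by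
    refine Set.Subset.antisymm (Set.range_subset_iff.2 h) ?_
    exact Set.pair_subset (MulAction.mem_orbit_self p) ⟨g₀, (h g₀).resolve_left hg₀⟩
  have hpq : p ≠ q := fun hpq ↦ hg₀ ((h g₀).elim id (·.trans hpq.symm))
  have hindex : (MulAction.stabilizer G p).index = 2 := by
    rw [MulAction.index_stabilizer, horbit, Set.ncard_pair hpq]
  rw [commutator_def, Subgroup.commutator_le]
  intro a _ b _
  simp only [commutatorElement_def, Subgroup.mul_mem_iff_of_index_two hindex, inv_mem_iff]
  tauto

theorem det_eq_one_of_mem_commutator {Γ R n : Type*} [Group Γ] [CommRing R] [Fintype n]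
    [DecidableEq n] (l : Γ →* GL n R) {x : Γ} (hx : x ∈ commutator Γ) : (l x).val.det = 1 := by
  have := Abelianization.commutator_subset_ker (Matrix.GeneralLinearGroup.det.comp l) hx
  exact congrArg Units.val this

end Solvability

section ProjectiveLine

variable {K : Type*} [Field K]

theorem isSolvable_of_upperTriangular {H : Subgroup (GL (Fin 2) K)} (h : ∀ g ∈ H, g 1 0 = 0) :
    Group.IsSolvable H := by
  let diag : H →* K × K :=
    { toFun g := (g.1 0 0, g.1 1 1)
      map_one' := by simp
      map_mul' g₁ g₂ := by simp [Matrix.mul_apply, h g₁ g₁.2, h g₂ g₂.2] }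
  have hker : IsMulCommutative diag.toHomUnits.ker := by
    refine ⟨⟨fun g₁ g₂ ↦ ?_⟩⟩
    have hdiag : ∀ g : diag.toHomUnits.ker, g.1.1 0 0 = 1 ∧ g.1.1 1 1 = 1 := fun g ↦
      Prod.mk.inj (congrArg Units.val (MonoidHom.mem_ker.1 g.2))
    have := h g₁ g₁.1.2
    have := h g₂ g₂.1.2
    ext i j
    fin_cases i <;> fin_cases j <;> simp [Matrix.mul_apply, *, add_comm]
  have : Group.IsSolvable diag.toHomUnits.ker :=
    Group.isSolvable_of_comm fun a b ↦ hker.1.1 a b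
  exact Group.isSolvable_of_ker_le_range diag.toHomUnits.ker.subtype diag.toHomUnits
    (by rw [Subgroup.range_subtype])

section DecidableEq

variable [DecidableEq K]

theorem isSolvable_of_le_stabilizer {H : Subgroup (GL (Fin 2) K)} {p : OnePoint K}
    (h : H ≤ MulAction.stabilizer (GL (Fin 2) K) p) : Group.IsSolvable H := by
  obtain ⟨P, rfl⟩ : ∃ P : GL (Fin 2) K, P • OnePoint.infty = p :=
    (p.exists_mem_SL2 K).elim fun g hg ↦ ⟨_, hg⟩
  have : Group.IsSolvable (H.map (MulAut.conj P⁻¹).toMonoidHom) := by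
    refine isSolvable_of_upperTriangular ?_
    rintro _ ⟨g, hg, rfl⟩
    rw [← OnePoint.smul_infty_eq_self_iff]
    have := h hg
    rw [MulAction.mem_stabilizer_iff] at this
    simp [mul_smul, this]
  exact isSolvable_of_isSolvable_map (MulAut.conj P⁻¹).injective this

theorem exists_smul_ne_and_ne {H : Subgroup (GL (Fin 2) K)} (hH : ¬ Group.IsSolvable H)
    (p q : OnePoint K) : ∃ g ∈ H, g • p ≠ p ∧ g • p ≠ q := by
  by_contra! hc
  have hstab : commutator H ≤ MulAction.stabilizer H p :=
    commutator_le_stabilizer_of_smul_eq_or_eq (q := q) fun g ↦ or_iff_not_imp_left.2 (hc g g.2)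
  refine hH (isSolvable_of_isSolvable_bracket (isSolvable_of_le_stabilizer (p := p) ?_))
  rw [← Subgroup.map_subtype_commutator, Subgroup.map_le_iff_le_comap]
  exact hstab

theorem smul_infty_eq_zero_iff {g : GL (Fin 2) K} :
    g • (OnePoint.infty : OnePoint K) = ((0 : K) : OnePoint K) ↔ g 0 0 = 0 := by
  have hdet := g.det_ne_zero
  rw [Matrix.det_fin_two] at hdet
  rw [OnePoint.smul_infty_eq_ite]
  split_ifs with h₁₀
  · refine iff_of_false (OnePoint.infty_ne_coe 0) fun h₀₀ ↦ hdet ?_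
    rw [h₀₀, h₁₀, zero_mul, mul_zero, sub_zero]
  · simp [h₁₀]

theorem smul_zero_eq_zero_iff {g : GL (Fin 2) K} :
    g • ((0 : K) : OnePoint K) = ((0 : K) : OnePoint K) ↔ g 0 1 = 0 := by
  have hdet := g.det_ne_zero
  rw [Matrix.det_fin_two] at hdet
  rw [OnePoint.smul_some_eq_ite, mul_zero, mul_zero, zero_add, zero_add]
  split_ifs with h₁₁
  · refine iff_of_false (OnePoint.infty_ne_coe 0) fun h₀₁ ↦ hdet ?_
    rw [h₀₁, h₁₁, zero_mul, mul_zero, sub_zero]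
  · simp [h₁₁]

end DecidableEq

theorem exists_apply_zero_zero_ne_zero_and_apply_one_zero_ne_zero {H : Subgroup (GL (Fin 2) K)}
    (hH : ¬ Group.IsSolvable H) : ∃ g ∈ H, g 0 0 ≠ 0 ∧ g 1 0 ≠ 0 := by
  classical
  obtain ⟨g, hg, hc, ha⟩ := exists_smul_ne_and_ne hH OnePoint.infty ((0 : K) : OnePoint K)
  exact ⟨g, hg, mt smul_infty_eq_zero_iff.2 ha, mt OnePoint.smul_infty_eq_self_iff.2 hc⟩

theorem exists_apply_zero_zero_ne_zero_and_apply_zero_one_ne_zero {H : Subgroup (GL (Fin 2) K)}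
    (hH : ¬ Group.IsSolvable H) : ∃ g ∈ H, g 0 0 ≠ 0 ∧ g 0 1 ≠ 0 := by
  classical
  obtain ⟨g, hg, hb, ha⟩ := exists_smul_ne_and_ne hH ((0 : K) : OnePoint K) OnePoint.infty
  have ha' : g⁻¹ • (OnePoint.infty : OnePoint K) ≠ ((0 : K) : OnePoint K) := fun h ↦
    ha (inv_smul_eq_iff.1 h).symm
  have hb' : g⁻¹ • ((0 : K) : OnePoint K) ≠ ((0 : K) : OnePoint K) := fun h ↦
    hb (inv_smul_eq_iff.1 h).symm
  exact ⟨g⁻¹, H.inv_mem hg, mt smul_infty_eq_zero_iff.2 ha', mt smul_zero_eq_zero_iff.2 hb'⟩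

end ProjectiveLine

section HyperbolicElements

theorem commute_of_commute_of_apply_one_zero_ne_zero {K : Type*} [Field K]
    {X Y Z : Matrix (Fin 2) (Fin 2) K} (hX : X 1 0 ≠ 0) (hY : Commute X Y) (hZ : Commute X Z) :
    Commute Y Z := by
  obtain ⟨α, β, rfl⟩ : ∃ α β : K, Y = α • X + β • 1 := by
    refine ⟨Y 1 0 / X 1 0, Y 0 0 - Y 1 0 / X 1 0 * X 0 0, ?_⟩
    have h₀₀ := congrFun₂ hY.eq 0 0
    have h₁₀ := congrFun₂ hY.eq 1 0
    simp only [Matrix.mul_apply, Fin.sum_univ_two] at h₀₀ h₁₀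
    ext i j
    fin_cases i <;> fin_cases j <;> simp <;> grind
  exact (hZ.smul_left α).add_left ((Commute.one_left Z).smul_left β)

theorem det_mul_sub_mul {R : Type*} [CommRing R] (g h : GL (Fin 2) R) (hg : g.val.det = 1)
    (hh : h.val.det = 1) : (g.val * h.val - h.val * g.val).det = 2 - (⁅g, h⁆.val).trace := by
  have hgh : g.val * h.val - h.val * g.val = (⁅g, h⁆.val - 1) * (h.val * g.val) := by
    simp only [sub_mul, one_mul, ← Units.val_mul, commutatorElement_def]
    congr 2
    group
  have hdet : (⁅g, h⁆.val).det = 1 := by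
    simp [commutatorElement_def, Matrix.det_mul, hg, hh]
  rw [hgh, Matrix.det_mul, Matrix.det_mul, hg, hh]
  rw [Matrix.det_fin_two] at hdet ⊢
  simp only [Matrix.sub_apply, Matrix.trace_fin_two, Matrix.one_fin_two, Matrix.of_apply,
    Matrix.cons_val', Matrix.cons_val_zero, Matrix.cons_val_one, Matrix.cons_val_fin_one]
  linear_combination hdet

theorem four_mul_det_mul_sub_mul {R : Type*} [CommRing R] (X Y : Matrix (Fin 2) (Fin 2) R) :
    4 * (X 0 1 * X 1 0) * (X * Y - Y * X).det =
      (X 1 0 * (X * Y - Y * X) 0 1 - X 0 1 * (X * Y - Y * X) 1 0) ^ 2 -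
        X.discr * (X * Y - Y * X) 0 0 ^ 2 := by
  simp only [Matrix.discr_fin_two, Matrix.trace_fin_two, Matrix.det_fin_two, Matrix.sub_apply,
    Matrix.mul_apply, Fin.sum_univ_two]
  ring

section OrderedField

variable {K : Type*} [Field K] [LinearOrder K] [IsStrictOrderedRing K]

theorem commute_of_isElliptic_of_det_nonneg {X Y : Matrix (Fin 2) (Fin 2) K} (hX : X.IsElliptic)
    (h : 0 ≤ (X * Y - Y * X).det) : Commute X Y := by
  -- The left side of `key` is nonpositive and the right side is a sum of two squares.
  have key := four_mul_det_mul_sub_mul X Y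
  set Z := X * Y - Y * X with hZ
  have hlin : X 1 0 * Z 0 1 + X 0 1 * Z 1 0 = -(X 0 0 - X 1 1) * Z 0 0 := by
    simp only [hZ, Matrix.sub_apply, Matrix.mul_apply, Fin.sum_univ_two]
    ring
  have htrace : Z 1 1 = -Z 0 0 := by
    simp only [hZ, Matrix.sub_apply, Matrix.mul_apply, Fin.sum_univ_two]
    ring
  have hdiscr : X.discr < 0 := hX
  have hbc : X 0 1 * X 1 0 < 0 := by
    rw [Matrix.discr_fin_two, Matrix.trace_fin_two, Matrix.det_fin_two] at hdiscr
    linarith [sq_nonneg (X 0 0 - X 1 1)]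
  have hsq : 0 ≤ -X.discr * Z 0 0 ^ 2 := mul_nonneg (neg_nonneg.2 hdiscr.le) (sq_nonneg _)
  have hdet : 4 * (X 0 1 * X 1 0) * Z.det ≤ 0 := mul_nonpos_of_nonpos_of_nonneg (by linarith) h
  have hZ₀₀ : Z 0 0 = 0 := by
    have : -X.discr * Z 0 0 ^ 2 = 0 := by
      linarith [sq_nonneg (X 1 0 * Z 0 1 - X 0 1 * Z 1 0)]
    simpa [hdiscr.ne] using this
  have heq : X 1 0 * Z 0 1 - X 0 1 * Z 1 0 = 0 := pow_eq_zero_iff two_ne_zero |>.1 <| by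
    linarith [sq_nonneg (X 1 0 * Z 0 1 - X 0 1 * Z 1 0)]
  rw [hZ₀₀, mul_zero] at hlin
  have hZ₀₁ : Z 0 1 = 0 := by
    have : X 1 0 * Z 0 1 = 0 := by linarith
    exact (mul_eq_zero.1 this).resolve_left (right_ne_zero_of_mul hbc.ne)
  have hZ₁₀ : Z 1 0 = 0 := by
    have : X 0 1 * Z 1 0 = 0 := by linarith
    exact (mul_eq_zero.1 this).resolve_left (left_ne_zero_of_mul hbc.ne)
  refine sub_eq_zero.1 (hZ.symm.trans ?_)
  rw [Z.eta_fin_two, htrace, hZ₀₀, hZ₀₁, hZ₁₀, neg_zero]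
  exact (Matrix.eta_fin_two 0).symm

end OrderedField

section Parabolic

theorem smul_one_add_pow_of_sq_eq_zero {R A : Type*} [CommRing R] [Ring A] [Algebra R A] {ε : R}
    {N : A} (hε : ε ^ 2 = 1) (hN : N ^ 2 = 0) (n : ℕ) :
    (ε • 1 + N) ^ n = ε ^ n • (1 + (n * ε) • N) := by
  induction n with
  | zero => simp
  | succ n ih =>
    rw [pow_succ, ih]
    simp only [add_mul, mul_add, smul_mul_assoc, one_mul, mul_one, mul_smul_comm, ← sq, hN]
    match_scalars
    · ring
    · linear_combination -ε ^ n * hε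

section Field

variable {K : Type*} [Field K] [NeZero (2 : K)]

theorem trace_pow_mul_sq_of_discr_eq_zero {X : Matrix (Fin 2) (Fin 2) K} (hX : X.discr = 0)
    (hdet : X.det = 1) (Y : Matrix (Fin 2) (Fin 2) K) (n : ℕ) :
    (X ^ n * Y).trace ^ 2 =
      (X.trace / 2 * Y.trace + n * ((X - Matrix.scalar _ (X.trace / 2)) * Y).trace) ^ 2 := by
  set ε := X.trace / 2 with hε_def
  set N := X - Matrix.scalar _ ε with hN_def
  have hε : ε ^ 2 = 1 := by
    rw [Matrix.discr_fin_two, hdet] at hX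
    rw [hε_def, div_pow, div_eq_one_iff_eq (pow_ne_zero 2 (NeZero.ne 2))]
    linear_combination hX
  have hN : N ^ 2 = 0 := by
    rw [hN_def, Matrix.sub_scalar_sq_eq_discr, hX, zero_div, map_zero]
  have hX_eq : X = ε • 1 + N := by simp [hN_def, Matrix.smul_one_eq_diagonal]
  have hεn : (ε ^ n) ^ 2 = 1 := by rw [← pow_mul, mul_comm, pow_mul, hε, one_pow]
  rw [hX_eq, smul_one_add_pow_of_sq_eq_zero hε hN]
  simp only [smul_mul_assoc, add_mul, one_mul, Matrix.trace_smul, Matrix.trace_add, smul_eq_mul]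
  linear_combination (Y.trace + n * ε * (N * Y).trace) ^ 2 * hεn +
    (n ^ 2 * (N * Y).trace ^ 2 - Y.trace ^ 2) * hε

theorem trace_sub_scalar_mul_of_discr_eq_zero {x : GL (Fin 2) K} (hx : x.val.discr = 0)
    (hx₁₀ : x 1 0 ≠ 0) (y : GL (Fin 2) K) :
    ((x.val - Matrix.scalar _ (x.val.trace / 2)) * y.val).trace =
      -x 1 0 * y.fixpointPolynomial.aeval ((x 0 0 - x 1 1) / (2 * x 1 0)) := by
  have h2 := NeZero.ne (2 : K)
  have hx₀₁ : x 0 1 = -(x 0 0 - x 1 1) ^ 2 / (2 ^ 2 * x 1 0) := by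
    rw [Matrix.discr_fin_two, Matrix.trace_fin_two, Matrix.det_fin_two] at hx
    rw [eq_div_iff (mul_ne_zero (pow_ne_zero 2 h2) hx₁₀)]
    linear_combination hx
  simp only [Matrix.GeneralLinearGroup.fixpointPolynomial, Matrix.trace_fin_two, Matrix.mul_apply,
    Fin.sum_univ_two, Matrix.sub_apply, Matrix.scalar_apply, Matrix.diagonal_apply_eq,
    Matrix.diagonal_apply_ne _ zero_ne_one, Matrix.diagonal_apply_ne _ one_ne_zero, map_add,
    map_sub, map_mul, map_pow, Polynomial.aeval_C, Polynomial.aeval_X, Algebra.algebraMap_self,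
    RingHom.id_apply, hx₀₁]
  field_simp
  ring

end Field

theorem exists_isHyperbolic_pow_mul {x y : GL (Fin 2) ℝ} (hx : x.val.discr = 0)
    (hx_det : x.val.det = 1) (hx₁₀ : x 1 0 ≠ 0) (hy_det : y.val.det = 1)
    (hy : y • (((x 0 0 - x 1 1) / (2 * x 1 0) : ℝ) : OnePoint ℝ) ≠
      ((x 0 0 - x 1 1) / (2 * x 1 0) : ℝ)) :
    ∃ n : ℕ, (x ^ n * y).IsHyperbolic := by
  set τ := ((x.val - Matrix.scalar _ (x.val.trace / 2)) * y.val).trace with hτ_def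
  have hτ : τ ≠ 0 := by
    rw [hτ_def, trace_sub_scalar_mul_of_discr_eq_zero hx hx₁₀]
    exact mul_ne_zero (neg_ne_zero.2 hx₁₀)
      (mt Matrix.GeneralLinearGroup.fixpointPolynomial_aeval_eq_zero_iff.1 hy)
  set σ := x.val.trace / 2 * y.val.trace with hσ
  obtain ⟨n, hn⟩ := exists_nat_gt ((2 + |σ|) / |τ|)
  have htrace : 2 < |σ + n * τ| := by
    rw [div_lt_iff₀ (abs_pos.2 hτ), ← Nat.abs_cast n, ← abs_mul] at hn
    have := abs_sub (σ + n * τ) σ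
    rw [add_sub_cancel_left] at this
    linarith
  refine ⟨n, ?_⟩
  have hdet : (x ^ n * y).val.det = 1 := by simp [Matrix.det_mul, Matrix.det_pow, hx_det, hy_det]
  rw [Matrix.GeneralLinearGroup.IsHyperbolic, Matrix.IsHyperbolic, Matrix.discr_fin_two, hdet,
    Units.val_mul, Units.val_pow_eq_pow_val, trace_pow_mul_sq_of_discr_eq_zero hx hx_det, ← hτ_def,
    ← hσ, ← sq_abs]
  nlinarith

end Parabolic

theorem exists_isHyperbolic {H : Subgroup (GL (Fin 2) ℝ)} (hH : ¬ Group.IsSolvable H)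
    (hdet : ∀ g ∈ H, g.val.det = 1) : ∃ g ∈ H, g.IsHyperbolic := by
  by_contra! hno
  have htrace : ∀ g ∈ H, g.val.trace ^ 2 ≤ 4 := fun g hg ↦ by
    have := not_lt.1 (hno g hg)
    rw [Matrix.discr_fin_two, hdet g hg] at this
    linarith
  obtain ⟨x, hxH, hx, -⟩ := exists_smul_ne_and_ne hH OnePoint.infty OnePoint.infty
  rw [ne_eq, OnePoint.smul_infty_eq_self_iff] at hx
  rcases (not_lt.1 (hno x hxH)).lt_or_eq with hell | hpar
  · have hcomm : ∀ y ∈ H, Commute x.val y.val := fun y hy ↦ by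
      refine commute_of_isElliptic_of_det_nonneg hell ?_
      rw [det_mul_sub_mul x y (hdet x hxH) (hdet y hy)]
      have := htrace ⁅x, y⁆ (H.mul_mem (H.mul_mem (H.mul_mem hxH hy) (H.inv_mem hxH))
        (H.inv_mem hy))
      nlinarith
    exact hH (Group.isSolvable_of_comm fun y z ↦ Subtype.ext <| Units.ext <|
      commute_of_commute_of_apply_one_zero_ne_zero hx (hcomm y y.2) (hcomm z z.2))
  · obtain ⟨y, hyH, hy, -⟩ := exists_smul_ne_and_ne hH
      (((x 0 0 - x 1 1) / (2 * x 1 0) : ℝ) : OnePoint ℝ) OnePoint.infty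
    obtain ⟨n, hn⟩ := exists_isHyperbolic_pow_mul hpar (hdet x hxH) hx (hdet y hyH) hy
    exact hno _ (H.mul_mem (H.pow_mem hxH n) hyH) hn

end HyperbolicElements

section ClosedSubgroups

theorem mem_of_tendsto_smul {E ι : Type*} [NormedAddCommGroup E] [NormedSpace ℝ E]
    {S : AddSubgroup E} (hS : IsClosed (S : Set E)) {l : Filter ι} [l.NeBot] {u : ι → E}
    {c : ι → ℝ} {d : E} (hu : ∀ᶠ i in l, u i ∈ S) (hu₀ : Tendsto u l (𝓝 0))
    (hd : Tendsto (fun i ↦ c i • u i) l (𝓝 d)) : d ∈ S := by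
  -- Rounding `c i` to an integer moves `c i • u i` by at most `‖u i‖`.
  have hfract : Tendsto (fun i ↦ (c i - round (c i)) • u i) l (𝓝 0) := by
    refine squeeze_zero_norm (fun i ↦ ?_) (tendsto_zero_iff_norm_tendsto_zero.1 hu₀)
    rw [norm_smul]
    exact mul_le_of_le_one_left (norm_nonneg _) ((abs_sub_round (c i)).trans (by norm_num))
  have hround : Tendsto (fun i ↦ round (c i) • u i) l (𝓝 d) := by
    refine (sub_zero d ▸ hd.sub hfract).congr fun i ↦ ?_
    rw [← sub_smul, sub_sub_cancel, Int.cast_smul_eq_zsmul]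
  exact hS.mem_of_tendsto hround (hu.mono fun i hi ↦ S.zsmul_mem hi _)

theorem tendsto_log_one_add_mul_pow_div_pow {ε : ℝ} (hε₀ : 0 < ε) (hε₁ : ε < 1) (x : ℝ) :
    Tendsto (fun n : ℕ ↦ Real.log (1 + x * ε ^ n) / ε ^ n) atTop (𝓝 x) := by
  have hderiv : HasDerivAt (fun s ↦ Real.log (1 + x * s)) x 0 := by
    have := (((hasDerivAt_id (0 : ℝ)).const_mul x).const_add 1).log (by simp)
    simpa using this
  have hpow : Tendsto (fun n : ℕ ↦ ε ^ n) atTop (𝓝[≠] 0) :=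
    tendsto_nhdsWithin_iff.2 ⟨tendsto_pow_atTop_nhds_zero_of_lt_one hε₀.le hε₁,
      .of_forall fun n ↦ (pow_pos hε₀ n).ne'⟩
  refine (hderiv.tendsto_slope.comp hpow).congr fun n ↦ ?_
  simp [slope_def_field]

theorem tendsto_log_one_add_mul_pow {ε : ℝ} (hε₀ : 0 < ε) (hε₁ : ε < 1) (x : ℝ) :
    Tendsto (fun n : ℕ ↦ Real.log (1 + x * ε ^ n)) atTop (𝓝 0) := by
  have := ((tendsto_pow_atTop_nhds_zero_of_lt_one hε₀.le hε₁).const_mul x).const_add 1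
  simpa using this.log (by simp)

variable {L : AddSubgroup (ℝ × ℝ)} {ε δ x y : ℝ}

theorem smul_mem_of_log_mem (hL : IsClosed (L : Set (ℝ × ℝ))) (hε₀ : 0 < ε) (hε₁ : ε < 1)
    (hmem : ∀ᶠ n : ℕ in atTop, (Real.log (1 + x * ε ^ n), Real.log (1 + y * ε ^ n)) ∈ L) (r : ℝ) :
    (r * x, r * y) ∈ L := by
  refine mem_of_tendsto_smul (c := fun n ↦ r / ε ^ n) hL hmem
    ((tendsto_log_one_add_mul_pow hε₀ hε₁ x).prodMk_nhds
      (tendsto_log_one_add_mul_pow hε₀ hε₁ y)) ?_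
  refine (((tendsto_log_one_add_mul_pow_div_pow hε₀ hε₁ x).const_mul r).prodMk_nhds
    ((tendsto_log_one_add_mul_pow_div_pow hε₀ hε₁ y).const_mul r)).congr fun n ↦ ?_
  simp only [Prod.smul_mk, smul_eq_mul, div_mul_eq_mul_div, mul_div_assoc]

theorem prod_zero_mem_of_log_mem (hL : IsClosed (L : Set (ℝ × ℝ))) (hδ₀ : 0 < δ) (hδε : δ < ε)
    (hε₁ : ε < 1)
    (hmem : ∀ᶠ n : ℕ in atTop, (Real.log (1 + x * ε ^ n), Real.log (1 + y * δ ^ n)) ∈ L) :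
    (x, 0) ∈ L := by
  have hε₀ := hδ₀.trans hδε
  have hδ₁ := hδε.trans hε₁
  refine mem_of_tendsto_smul (c := fun n ↦ (ε ^ n)⁻¹) hL hmem
    ((tendsto_log_one_add_mul_pow hε₀ hε₁ x).prodMk_nhds
      (tendsto_log_one_add_mul_pow hδ₀ hδ₁ y)) ?_
  have hquot : Tendsto (fun n : ℕ ↦ Real.log (1 + y * δ ^ n) / δ ^ n * (δ / ε) ^ n) atTop
      (𝓝 0) := by
    simpa using (tendsto_log_one_add_mul_pow_div_pow hδ₀ hδ₁ y).mul
      (tendsto_pow_atTop_nhds_zero_of_lt_one (div_pos hδ₀ hε₀).le ((div_lt_one hε₀).2 hδε))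
  refine ((tendsto_log_one_add_mul_pow_div_pow hε₀ hε₁ x).prodMk_nhds hquot).congr fun n ↦ ?_
  have := (pow_pos hδ₀ n).ne'
  rw [Prod.smul_mk, smul_eq_mul, smul_eq_mul, div_pow]
  field_simp

theorem ne_zero_of_log_mem (hfst : ∀ a, (a, 0) ∈ L → a = 0) (hε₀ : 0 < ε) (hε₁ : ε < 1)
    (hx : x ≠ 0)
    (hmem : ∀ᶠ n : ℕ in atTop, (Real.log (1 + x * ε ^ n), Real.log (1 + y * δ ^ n)) ∈ L) :
    y ≠ 0 := by
  rintro rfl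
  refine hx (tendsto_nhds_unique (tendsto_log_one_add_mul_pow_div_pow hε₀ hε₁ x) ?_)
  refine tendsto_const_nhds.congr' (hmem.mono fun n hn ↦ ?_)
  rw [zero_mul, add_zero, Real.log_one] at hn
  simp only [hfst _ hn, zero_div]

theorem eq_of_log_mem (hL : IsClosed (L : Set (ℝ × ℝ))) (hfst : ∀ a, (a, 0) ∈ L → a = 0)
    (hsnd : ∀ b, (0, b) ∈ L → b = 0) (hε₀ : 0 < ε) (hε₁ : ε < 1) (hδ₀ : 0 < δ) (hδ₁ : δ < 1)
    (hx : x ≠ 0)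
    (hmem : ∀ᶠ n : ℕ in atTop, (Real.log (1 + x * ε ^ n), Real.log (1 + y * δ ^ n)) ∈ L) :
    ε = δ := by
  refine le_antisymm (not_lt.1 fun hδε ↦ ?_) (not_lt.1 fun hεδ ↦ ?_)
  · exact hx (hfst x (prod_zero_mem_of_log_mem hL hδ₀ hδε hε₁ hmem))
  · exact ne_zero_of_log_mem hfst hε₀ hε₁ hx hmem (hsnd y (prod_zero_mem_of_log_mem
      (L := L.comap (AddEquiv.prodComm : ℝ × ℝ ≃+ ℝ × ℝ).toAddMonoidHom)
      (hL.preimage continuous_swap) hε₀ hεδ hδ₁ hmem))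

theorem diag_mem_of_log_mem (hL : IsClosed (L : Set (ℝ × ℝ))) (hfst : ∀ a, (a, 0) ∈ L → a = 0)
    (hsnd : ∀ b, (0, b) ∈ L → b = 0) (hε₀ : 0 < ε) (hε₁ : ε < 1) (hδ₀ : 0 < δ) (hδ₁ : δ < 1)
    (hεδ : (Real.log ε, Real.log δ) ∈ L) (hx : x ≠ 0)
    (hmem : ∀ᶠ n : ℕ in atTop, (Real.log (1 + x * ε ^ n), Real.log (1 + y * δ ^ n)) ∈ L) (t : ℝ) :
    (t, t) ∈ L := by
  obtain rfl := eq_of_log_mem hL hfst hsnd hε₀ hε₁ hδ₀ hδ₁ hx hmem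
  have hline := smul_mem_of_log_mem hL hε₀ hε₁ hmem
  have hxy : y = x := by
    have hdiff := L.sub_mem (hline (Real.log ε / x)) hεδ
    rw [div_mul_cancel₀ _ hx, Prod.mk_sub_mk, sub_self] at hdiff
    have hlog : Real.log ε ≠ 0 := (Real.log_neg hε₀ hε₁).ne
    have := sub_eq_zero.1 (hsnd _ hdiff)
    field_simp at this
    exact this
  simpa [hxy, hx] using hline (t / x)

/-- The exponential as a unit of `ℝ`, used to pass from subgroups of `ℝˣ × ℝˣ` to subgroups of
`ℝ × ℝ`. -/
noncomputable def expUnit (t : ℝ) : ℝˣ :=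
  Units.mk0 (Real.exp t) (Real.exp_ne_zero t)

theorem expUnit_zero : expUnit 0 = 1 :=
  Units.ext Real.exp_zero

theorem expUnit_add (s t : ℝ) : expUnit (s + t) = expUnit s * expUnit t :=
  Units.ext (Real.exp_add s t)

theorem expUnit_neg (t : ℝ) : expUnit (-t) = (expUnit t)⁻¹ :=
  Units.ext (Real.exp_neg t)

theorem expUnit_log {s : ℝˣ} (hs : 0 < (s : ℝ)) : expUnit (Real.log s) = s :=
  Units.ext (Real.exp_log hs)

theorem expUnit_eq_one_iff {t : ℝ} : expUnit t = 1 ↔ t = 0 :=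
  Units.ext_iff.trans (Real.exp_eq_one_iff t)

theorem continuous_expUnit : Continuous expUnit :=
  Units.isEmbedding_val₀.continuous_iff.2 Real.continuous_exp

/-- The logarithms of the pairs of positive numbers in a subgroup of `ℝˣ × ℝˣ`. -/
def logSubgroup (P : Subgroup (ℝˣ × ℝˣ)) : AddSubgroup (ℝ × ℝ) where
  carrier := {t | (expUnit t.1, expUnit t.2) ∈ P}
  zero_mem' := by
    change (expUnit 0, expUnit 0) ∈ P
    rw [expUnit_zero]
    exact P.one_mem
  add_mem' {s t} hs ht := by
    change (expUnit (s.1 + t.1), expUnit (s.2 + t.2)) ∈ P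
    rw [expUnit_add, expUnit_add]
    exact P.mul_mem hs ht
  neg_mem' {t} ht := by
    change (expUnit (-t.1), expUnit (-t.2)) ∈ P
    rw [expUnit_neg, expUnit_neg]
    exact P.inv_mem ht

theorem mem_logSubgroup {P : Subgroup (ℝˣ × ℝˣ)} {s t : ℝ} :
    (s, t) ∈ logSubgroup P ↔ (expUnit s, expUnit t) ∈ P := Iff.rfl

variable {P : Subgroup (ℝˣ × ℝˣ)}

theorem isClosed_logSubgroup (hP : IsClosed (P : Set (ℝˣ × ℝˣ))) :
    IsClosed (logSubgroup P : Set (ℝ × ℝ)) :=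
  hP.preimage (continuous_expUnit.prodMap continuous_expUnit)

theorem log_mem_logSubgroup {p : ℝˣ × ℝˣ} (hp : p ∈ P) (h₁ : 0 < (p.1 : ℝ)) (h₂ : 0 < (p.2 : ℝ)) :
    (Real.log p.1, Real.log p.2) ∈ logSubgroup P := by
  rwa [mem_logSubgroup, expUnit_log h₁, expUnit_log h₂]

theorem fst_eq_snd_of_diag_mem (hfst : ∀ s, (s, 1) ∈ P → s = 1) (hsnd : ∀ c, (1, c) ∈ P → c = 1)
    (hdiag : ∀ s : ℝˣ, 0 < (s : ℝ) → (s, s) ∈ P) {p : ℝˣ × ℝˣ} (hp : p ∈ P) : p.1 = p.2 := by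
  obtain ⟨s, c⟩ := p
  rcases lt_or_gt_of_ne s.ne_zero with hs | hs
  · have hmem : (-1, c / -s) ∈ P := by
      simpa [div_neg] using P.div_mem hp (hdiag (-s) (by simpa using hs))
    have hsq : (c / -s) ^ 2 = 1 := hsnd _ (by simpa [sq] using P.pow_mem hmem 2)
    rcases sq_eq_one_iff.1 (congrArg Units.val hsq) with h | h
    · have hquot : c / -s = 1 := Units.ext h
      have hneg : ((-1 : ℝˣ) : ℝ) = 1 := congrArg Units.val (hfst (-1) (hquot ▸ hmem))
      norm_num at hneg
    · have hquot : c / -s = -1 := Units.ext h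
      simpa [div_neg, div_eq_one, eq_comm] using hquot
  · have hmem : (1, c / s) ∈ P := by
      simpa using P.div_mem hp (hdiag s hs)
    exact (div_eq_one.1 (hsnd _ hmem)).symm

theorem inv_sq_pos (r : ℝˣ) : 0 < ((r : ℝ) ^ 2)⁻¹ :=
  inv_pos.2 (pow_two_pos_of_ne_zero r.ne_zero)

theorem inv_sq_lt_one {r : ℝˣ} (hr : 1 < |(r : ℝ)|) : ((r : ℝ) ^ 2)⁻¹ < 1 :=
  inv_lt_one_of_one_lt₀ ((one_lt_sq_iff_one_lt_abs _).2 hr)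

theorem eventually_one_add_mul_inv_sq_pow_pos {r : ℝˣ} (hr : 1 < |(r : ℝ)|) (x : ℝ) :
    ∀ᶠ n : ℕ in atTop, 0 < 1 + x * ((r : ℝ) ^ 2)⁻¹ ^ n := by
  have := ((tendsto_pow_atTop_nhds_zero_of_lt_one (inv_sq_pos r).le (inv_sq_lt_one hr)).const_mul
    x).const_add 1
  rw [mul_zero, add_zero] at this
  exact this.eventually_const_lt one_pos

theorem fst_eq_snd_of_mem (hP : IsClosed (P : Set (ℝˣ × ℝˣ))) (hfst : ∀ s, (s, 1) ∈ P → s = 1)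
    (hsnd : ∀ c, (1, c) ∈ P → c = 1) {μ ν : ℝˣ} (hμ : 1 < |(μ : ℝ)|) (hν : 1 < |(ν : ℝ)|)
    (hμν : (μ, ν) ∈ P) {x y : ℝ} (hx : x ≠ 0)
    (hmem : ∀ᶠ n : ℕ in atTop, ∃ p ∈ P,
      (p.1 : ℝ) = 1 + x * ((μ : ℝ) ^ 2)⁻¹ ^ n ∧ (p.2 : ℝ) = 1 + y * ((ν : ℝ) ^ 2)⁻¹ ^ n)
    {p : ℝˣ × ℝˣ} (hp : p ∈ P) : p.1 = p.2 := by
  have hdiag : ∀ t, (t, t) ∈ logSubgroup P := by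
    refine diag_mem_of_log_mem (y := y) (isClosed_logSubgroup hP) (fun a ha ↦ ?_) (fun b hb ↦ ?_)
      (inv_sq_pos μ) (inv_sq_lt_one hμ) (inv_sq_pos ν) (inv_sq_lt_one hν) ?_ hx ?_
    · exact expUnit_eq_one_iff.1 (hfst _ (by rwa [mem_logSubgroup, expUnit_zero] at ha))
    · exact expUnit_eq_one_iff.1 (hsnd _ (by rwa [mem_logSubgroup, expUnit_zero] at hb))
    · simpa using log_mem_logSubgroup (P.inv_mem (P.pow_mem hμν 2)) (by simpa using inv_sq_pos μ)
        (by simpa using inv_sq_pos ν)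
    · filter_upwards [hmem, eventually_one_add_mul_inv_sq_pow_pos hμ x,
        eventually_one_add_mul_inv_sq_pow_pos hν y] with n ⟨p, hp, h₁, h₂⟩ hpos₁ hpos₂
      rw [← h₁, ← h₂] at *
      exact log_mem_logSubgroup hp hpos₁ hpos₂
  refine fst_eq_snd_of_diag_mem hfst hsnd (fun s hs ↦ ?_) hp
  simpa only [mem_logSubgroup, expUnit_log hs] using hdiag (Real.log s)

end ClosedSubgroups

theorem exists_conj_of_apply_zero_zero_eq {Γ K : Type*} [Group Γ] [Field K]
    {l₁ l₂ : Γ →* GL (Fin 2) K} (h₀₀ : ∀ γ, l₁ γ 0 0 = l₂ γ 0 0) {y w : Γ} (hy : l₁ y 0 1 ≠ 0)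
    (hw : l₁ w 1 0 ≠ 0) : ∃ k : GL (Fin 2) K, ∀ γ, l₂ γ = k * l₁ γ * k⁻¹ := by
  have hmul (l : Γ →* GL (Fin 2) K) (α β : Γ) (i j : Fin 2) :
      l (α * β) i j = l α i 0 * l β 0 j + l α i 1 * l β 1 j := by
    simp [Matrix.mul_apply]
  have hprod (α β : Γ) : l₁ α 0 1 * l₁ β 1 0 = l₂ α 0 1 * l₂ β 1 0 := by
    have := h₀₀ (α * β)
    rwa [hmul, hmul, h₀₀, h₀₀, add_left_cancel_iff] at this
  have hy' : l₂ y 0 1 ≠ 0 := left_ne_zero_of_mul (hprod y w ▸ mul_ne_zero hy hw)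
  have hc (γ : Γ) : l₂ γ 1 0 = l₁ y 0 1 / l₂ y 0 1 * l₁ γ 1 0 := by
    rw [div_mul_eq_mul_div, hprod, mul_div_cancel_left₀ _ hy']
  have hb (γ : Γ) : l₂ γ 0 1 = l₂ y 0 1 / l₁ y 0 1 * l₁ γ 0 1 := by
    have := hprod γ w
    rw [hc w, ← mul_assoc] at this
    rw [mul_right_cancel₀ hw this]
    field_simp
  have hd (γ : Γ) : l₂ γ 1 1 = l₁ γ 1 1 := by
    have := hb (y * γ)
    rw [hmul, hmul, hb γ, h₀₀] at this
    field_simp at this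
    exact mul_left_cancel₀ hy (add_left_cancel this)
  let k : GL (Fin 2) K := .mkOfDetNeZero !![l₂ y 0 1 / l₁ y 0 1, 0; 0, 1] (by simp [hy, hy'])
  refine ⟨k, fun γ ↦ eq_mul_inv_of_mul_eq (Matrix.GeneralLinearGroup.ext fun i j ↦ ?_)⟩
  fin_cases i <;> fin_cases j <;>
    simp [k, Matrix.mul_apply, h₀₀, hb γ, hc γ, hd γ, Matrix.GeneralLinearGroup.mkOfDetNeZero] <;>
    field_simp

/-- The pairs of group elements whose actions are intertwined by `f`. -/
def semiconjPairs (G H : Type*) {α β : Type*} [Group G] [Group H] [MulAction G α] [MulAction H β]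
    (f : α → β) : Subgroup (G × H) where
  carrier := {p | ∀ a, f (p.1 • a) = p.2 • f a}
  one_mem' a := by simp
  mul_mem' {p q} hp hq a := by
    simp only [Prod.fst_mul, Prod.snd_mul, mul_smul, hp _, hq _]
  inv_mem' {p} hp a := by
    rw [Prod.fst_inv, Prod.snd_inv, eq_inv_smul_iff, ← hp, smul_inv_smul]

section SemiconjPairs

variable {G H α β : Type*} [Group G] [Group H] [MulAction G α] [MulAction H β] {f : α → β}

theorem isClosed_semiconjPairs [TopologicalSpace G] [TopologicalSpace H] [TopologicalSpace α]
    [TopologicalSpace β] [ContinuousSMul G α] [ContinuousSMul H β] [T2Space β]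
    (hf : Continuous f) : IsClosed (semiconjPairs G H f : Set (G × H)) := by
  have : (semiconjPairs G H f : Set (G × H)) = ⋂ a, {p | f (p.1 • a) = p.2 • f a} := by
    ext p
    simp only [Set.mem_iInter]
    rfl
  rw [this]
  exact isClosed_iInter fun a ↦ isClosed_eq (hf.comp (continuous_fst.smul continuous_const))
    (continuous_snd.smul continuous_const)

end SemiconjPairs

instance {R E : Type*} [Monoid R] [TopologicalSpace R] [AddCommMonoid E] [TopologicalSpace E]
    [DistribMulAction R E] [ContinuousSMul R E] : ContinuousSMul Rˣ {v : E // v ≠ 0} where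
  continuous_smul :=
    (continuous_fst.smul (continuous_subtype_val.comp continuous_snd)).subtype_mk _

instance {n R : Type*} [Fintype n] [DecidableEq n] [Semiring R] [TopologicalSpace R]
    [IsTopologicalSemiring R] : ContinuousSMul (Matrix n n R) (n → R) where
  continuous_smul := continuous_fst.matrix_mulVec continuous_snd

/-- The punctured plane `ℝ² ∖ {0}`, to which the annulus is equivariantly homeomorphic. -/
abbrev PuncturedPlane : Type := {p : Fin 2 → ℝ // p ≠ 0}

/-- `F` conjugates the action of `Γ` on the punctured plane through `l₁` to the one through
`l₂`. -/
def Intertwines {Γ : Type*} [Group Γ] (F : PuncturedPlane ≃ₜ PuncturedPlane)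
    (l₁ l₂ : Γ →* GL (Fin 2) ℝ) : Prop :=
  ∀ (γ : Γ) (p : PuncturedPlane), F (l₁ γ • p) = l₂ γ • F p

theorem Intertwines.symm {Γ : Type*} [Group Γ] {F : PuncturedPlane ≃ₜ PuncturedPlane}
    {l₁ l₂ : Γ →* GL (Fin 2) ℝ} (hF : Intertwines F l₁ l₂) : Intertwines F.symm l₂ l₁ := by
  intro γ p
  rw [F.symm_apply_eq, hF, F.apply_symm_apply]

/-- The homomorphism `r ↦ diag(r, r⁻¹)`; hyperbolic matrices of determinant one are conjugate to
such matrices. -/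
def diagInv (R : Type*) [CommRing R] : Rˣ →* GL (Fin 2) R where
  toFun r := ⟨!![r.1, 0; 0, r⁻¹.1], !![r⁻¹.1, 0; 0, r.1], by simp [Matrix.one_fin_two],
    by simp [Matrix.one_fin_two]⟩
  map_one' := Units.ext (by simp [Matrix.one_fin_two])
  map_mul' r s := Units.ext (by simp [mul_comm])

theorem coe_diagInv {R : Type*} [CommRing R] (r : Rˣ) :
    (diagInv R r : Matrix (Fin 2) (Fin 2) R) = !![r.1, 0; 0, r⁻¹.1] := rfl

theorem exists_mul_eq_mul_diagonal {n K : Type*} [Fintype n] [DecidableEq n] [Field K]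
    {A : Matrix n n K} {μ : n → K} (hμ : Function.Injective μ)
    (hA : ∀ i, Module.End.HasEigenvalue (Matrix.toLin' A) (μ i)) :
    ∃ P : GL n K, A * P.val = P.val * Matrix.diagonal μ := by
  choose v hv using fun i ↦ (hA i).exists_hasEigenvector
  have hunit : IsUnit (Matrix.of v).transpose :=
    Matrix.linearIndependent_cols_iff_isUnit.1
      (Module.End.eigenvectors_linearIndependent' _ _ hμ v hv)
  refine ⟨hunit.unit, Matrix.ext fun i j ↦ ?_⟩
  have := congrFun (hv j).apply_eq_smul i
  rw [IsUnit.unit_spec, Matrix.mul_diagonal, Matrix.mul_apply]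
  simpa [Matrix.mulVec, dotProduct, mul_comm] using this

theorem exists_one_lt_abs_add_inv_eq {t : ℝ} (ht : 4 < t ^ 2) :
    ∃ r : ℝˣ, 1 < |(r : ℝ)| ∧ (r : ℝ) + (r⁻¹ : ℝˣ) = t := by
  wlog h : 0 ≤ t generalizing t
  · obtain ⟨r, hr, hrt⟩ := this (t := -t) (by rwa [neg_sq]) (by linarith)
    exact ⟨-r, by simpa using hr, by rw [inv_neg, Units.val_neg, Units.val_neg]; linarith⟩
  have hs : √(t ^ 2 - 4) ^ 2 = t ^ 2 - 4 := Real.sq_sqrt (by linarith)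
  have ht₂ : 2 < t := lt_of_pow_lt_pow_left₀ 2 h (by linarith)
  have hr : 1 < (t + √(t ^ 2 - 4)) / 2 := by linarith [Real.sqrt_nonneg (t ^ 2 - 4)]
  have hr₀ := (zero_lt_one.trans hr).ne'
  have hinv : ((t + √(t ^ 2 - 4)) / 2)⁻¹ = (t - √(t ^ 2 - 4)) / 2 :=
    inv_eq_of_mul_eq_one_right (by linear_combination -hs / 4)
  refine ⟨Units.mk0 _ hr₀, hr.trans_le (le_abs_self _), ?_⟩
  rw [Units.val_inv_eq_inv_val, Units.val_mk0, hinv]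
  ring

theorem exists_conj_eq_diagInv {g : GL (Fin 2) ℝ} (hg : g.IsHyperbolic) (hdet : g.val.det = 1) :
    ∃ (P : GL (Fin 2) ℝ) (r : ℝˣ), 1 < |(r : ℝ)| ∧ P * g * P⁻¹ = diagInv ℝ r := by
  have ht : 4 < g.val.trace ^ 2 := by
    have : 0 < g.val.discr := hg
    rw [Matrix.discr_fin_two, hdet] at this
    linarith
  obtain ⟨r, hr, hrt⟩ := exists_one_lt_abs_add_inv_eq ht
  have heig (s : ℝˣ) (hs : (s : ℝ) + (s⁻¹ : ℝˣ) = g.val.trace) :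
      Module.End.HasEigenvalue (Matrix.toLin' g.val) s := by
    rw [Module.End.hasEigenvalue_iff_isRoot_charpoly, Matrix.charpoly_toLin',
      Matrix.charpoly_fin_two, hdet, ← hs]
    have : (s : ℝ) * (s⁻¹ : ℝˣ) = 1 := s.mul_inv
    simp only [Polynomial.IsRoot, Polynomial.eval_add, Polynomial.eval_sub, Polynomial.eval_pow,
      Polynomial.eval_mul, Polynomial.eval_X, Polynomial.eval_C]
    linear_combination -this
  have hne : (r : ℝ) ≠ (r⁻¹ : ℝˣ) := by
    intro h
    have : |(r : ℝ)| ^ 2 = 1 := by rw [sq_abs, sq, ← r.mul_inv, ← h]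
    exact hr.ne' ((pow_eq_one_iff_of_nonneg (abs_nonneg _) two_ne_zero).1 this)
  obtain ⟨Q, hQ⟩ := exists_mul_eq_mul_diagonal (μ := ![(r : ℝ), (r⁻¹ : ℝˣ)]) (A := g.val)
    (by simp [Function.Injective, Fin.forall_fin_two, -Units.val_inv_eq_inv_val, hne, hne.symm])
    (Fin.forall_fin_two.2 ⟨heig r hrt, heig r⁻¹ (by rwa [inv_inv, add_comm])⟩)
  have hgQ : g * Q = Q * diagInv ℝ r := Units.ext <| hQ.trans <| by
    simp [coe_diagInv, Matrix.diagonal_fin_two]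
  exact ⟨Q⁻¹, r, hr, by rw [inv_inv, mul_assoc, hgQ, inv_mul_cancel_left]⟩

section Axis

/-- The point `(1, 0)`, which spans the expanding axis of `diagInv ℝ μ` when `1 < |μ|`. -/
def axisPoint : PuncturedPlane := ⟨![1, 0], fun h ↦ one_ne_zero (congrFun h 0)⟩

theorem eq_of_smul_eq_smul {r s : ℝˣ} {p : PuncturedPlane} (h : r • p = s • p) : r = s :=
  Units.ext (smul_left_injective ℝ p.2 (congrArg Subtype.val h))

/-- The pairs `(s, c)` such that `F` turns scaling by `s` along the first axis into scaling
by `c`. -/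
def axisPairs (F : PuncturedPlane ≃ₜ PuncturedPlane) : Subgroup (ℝˣ × ℝˣ) :=
  semiconjPairs ℝˣ ℝˣ fun t : ℝˣ ↦ F (t • axisPoint)

theorem isClosed_axisPairs (F : PuncturedPlane ≃ₜ PuncturedPlane) :
    IsClosed (axisPairs F : Set (ℝˣ × ℝˣ)) :=
  isClosed_semiconjPairs (F.continuous.comp (continuous_id.smul continuous_const))

theorem eq_one_of_mk_one_mem_axisPairs {F : PuncturedPlane ≃ₜ PuncturedPlane} {s : ℝˣ}
    (hs : (s, 1) ∈ axisPairs F) : s = 1 := by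
  have := F.injective ((hs 1).trans (one_smul _ _))
  simpa using eq_of_smul_eq_smul this

theorem eq_one_of_one_mk_mem_axisPairs {F : PuncturedPlane ≃ₜ PuncturedPlane} {c : ℝˣ}
    (hc : (1, c) ∈ axisPairs F) : c = 1 := by
  have := hc 1
  simp only [one_smul] at this
  exact (eq_of_smul_eq_smul ((one_smul ℝˣ _).trans this)).symm

theorem tendsto_inv_pow_nhds_zero {r : ℝˣ} (hr : 1 < |(r : ℝ)|) :
    Tendsto (fun n : ℕ ↦ ((r ^ n)⁻¹ : ℝˣ).1) atTop (𝓝 0) := by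
  simp only [← inv_pow, Units.val_pow_eq_pow_val, Units.val_inv_eq_inv_val]
  exact tendsto_pow_atTop_nhds_zero_of_abs_lt_one (by rw [abs_inv]; exact inv_lt_one_of_one_lt₀ hr)

theorem tendsto_diagInv_conj_smul {μ : ℝˣ} (hμ : 1 < |(μ : ℝ)|) (g : GL (Fin 2) ℝ)
    {v : Fin 2 → ℝ} (hv : v 1 = 0) :
    Tendsto (fun n : ℕ ↦ (diagInv ℝ μ ^ n * g * (diagInv ℝ μ ^ n)⁻¹) • v) atTop
      (𝓝 (g 0 0 • v)) := by
  have hzero : Tendsto (fun n : ℕ ↦ (μ ^ n)⁻¹.1 * (g 1 0 * ((μ ^ n)⁻¹.1 * v 0))) atTop (𝓝 0) := by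
    have := tendsto_inv_pow_nhds_zero hμ
    simpa using this.mul ((this.mul_const (v 0)).const_mul (g 1 0))
  refine tendsto_pi_nhds.2 (Fin.forall_fin_two.2 ⟨?_, ?_⟩)
  · refine tendsto_const_nhds.congr fun n ↦ ?_
    simp [mul_smul, ← map_pow, ← map_inv, coe_diagInv, hv, mul_left_comm ((μ : ℝ) ^ n)]
  · simpa [mul_smul, ← map_pow, ← map_inv, coe_diagInv, hv] using hzero

variable {Γ : Type*} [Group Γ] {F : PuncturedPlane ≃ₜ PuncturedPlane} {l₁ l₂ : Γ →* GL (Fin 2) ℝ}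
  {x : Γ} {μ ν : ℝˣ}

theorem Intertwines.apply_axis (hF : Intertwines F l₁ l₂) (hx₁ : l₁ x = diagInv ℝ μ)
    (hx₂ : l₂ x = diagInv ℝ ν) (hμ : 1 < |(μ : ℝ)|) (hν : 1 < |(ν : ℝ)|) {p : PuncturedPlane}
    (hp : p.1 1 = 0) : (F p).1 1 = 0 := by
  -- `l₁ (x ^ n) • q (μ ^ n)⁻¹` tends to `p` although `q (μ ^ n)⁻¹` converges, and on the other
  -- side of `F` the second coordinate is contracted by `(ν ^ n)⁻¹`.
  let q (s : ℝ) : PuncturedPlane := ⟨![s * p.1 0, 1], fun h ↦ one_ne_zero (congrFun h 1)⟩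
  have hx₁' (n : ℕ) : l₁ (x ^ n) = diagInv ℝ (μ ^ n) := by rw [map_pow, hx₁, map_pow]
  have hx₂' (n : ℕ) : l₂ (x ^ n) = diagInv ℝ (ν ^ n) := by rw [map_pow, hx₂, map_pow]
  have hq : Tendsto (fun n : ℕ ↦ q (μ ^ n)⁻¹.1) atTop (𝓝 (q 0)) := by
    refine tendsto_subtype_rng.2 (tendsto_pi_nhds.2 (Fin.forall_fin_two.2 ⟨?_, ?_⟩))
    · exact (tendsto_inv_pow_nhds_zero hμ).mul_const _
    · exact tendsto_const_nhds
  have hxq : Tendsto (fun n : ℕ ↦ l₁ (x ^ n) • q (μ ^ n)⁻¹.1) atTop (𝓝 p) := by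
    refine tendsto_subtype_rng.2 (tendsto_pi_nhds.2 (Fin.forall_fin_two.2 ⟨?_, ?_⟩))
    · simp [hx₁', coe_diagInv, q, -map_pow]
    · simpa [hx₁', coe_diagInv, q, hp, -map_pow] using tendsto_inv_pow_nhds_zero hμ
  have hcoord {u : ℕ → PuncturedPlane} {v : PuncturedPlane} (hu : Tendsto u atTop (𝓝 v)) :
      Tendsto (fun n ↦ (F (u n)).1 1) atTop (𝓝 ((F v).1 1)) :=
    tendsto_pi_nhds.1 (tendsto_subtype_rng.1 ((F.continuous.tendsto v).comp hu)) 1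
  refine tendsto_nhds_unique (hcoord hxq) ?_
  simpa [hF _ _, hx₂', coe_diagInv, -map_pow] using
    (tendsto_inv_pow_nhds_zero hν).mul (hcoord hq)

theorem Intertwines.apply_smul_axis (hF : Intertwines F l₁ l₂) (hx₁ : l₁ x = diagInv ℝ μ)
    (hx₂ : l₂ x = diagInv ℝ ν) (hμ : 1 < |(μ : ℝ)|) (hν : 1 < |(ν : ℝ)|) {γ : Γ} {s : ℝˣ}
    (hs : l₁ γ 0 0 = s) {p : PuncturedPlane} (hp : p.1 1 = 0) :
    (F (s • p)).1 = l₂ γ 0 0 • (F p).1 := by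
  let conj (n : ℕ) : Γ := x ^ n * γ * (x ^ n)⁻¹
  have h₁ : Tendsto (fun n ↦ l₁ (conj n) • p) atTop (𝓝 (s • p)) := by
    refine tendsto_subtype_rng.2 ?_
    simpa [conj, hx₁, Units.smul_def, ← hs] using tendsto_diagInv_conj_smul hμ (l₁ γ) hp
  have h₂ : Tendsto (fun n ↦ l₂ (conj n) • (F p).1) atTop (𝓝 (l₂ γ 0 0 • (F p).1)) := by
    simpa [conj, hx₂] using
      tendsto_diagInv_conj_smul hν (l₂ γ) (hF.apply_axis hx₁ hx₂ hμ hν hp)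
  refine tendsto_nhds_unique (tendsto_subtype_rng.1 ((F.continuous.tendsto _).comp h₁)) ?_
  simpa [hF _ _] using h₂

theorem Intertwines.exists_mem_axisPairs (hF : Intertwines F l₁ l₂) (hx₁ : l₁ x = diagInv ℝ μ)
    (hx₂ : l₂ x = diagInv ℝ ν) (hμ : 1 < |(μ : ℝ)|) (hν : 1 < |(ν : ℝ)|) {γ : Γ} {s : ℝˣ}
    (hs : l₁ γ 0 0 = s) :
    ∃ c : ℝˣ, l₂ γ 0 0 = c ∧ (s, c) ∈ axisPairs F := by
  have hsmul (p : PuncturedPlane) (hp : p.1 1 = 0) : (F (s • p)).1 = l₂ γ 0 0 • (F p).1 :=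
    hF.apply_smul_axis hx₁ hx₂ hμ hν hs hp
  have hne : l₂ γ 0 0 ≠ 0 := fun h ↦
    (F (s • axisPoint)).2 (by rw [hsmul axisPoint rfl, h, zero_smul])
  refine ⟨Units.mk0 _ hne, rfl, fun t ↦ Subtype.ext ?_⟩
  have ht : (t • axisPoint).1 1 = 0 := by simp [axisPoint]
  rw [Units.smul_coe, Units.smul_def, Units.val_mk0, ← hsmul _ ht, smul_smul, smul_eq_mul]

theorem Intertwines.mk_mem_axisPairs (hF : Intertwines F l₁ l₂) (hx₁ : l₁ x = diagInv ℝ μ)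
    (hx₂ : l₂ x = diagInv ℝ ν) (hμ : 1 < |(μ : ℝ)|) (hν : 1 < |(ν : ℝ)|) :
    (μ, ν) ∈ axisPairs F := by
  obtain ⟨c, hc, hcP⟩ := hF.exists_mem_axisPairs hx₁ hx₂ hμ hν (γ := x) (s := μ)
    (by simp [hx₁, coe_diagInv])
  obtain rfl : ν = c := Units.ext (by simpa [hx₂, coe_diagInv] using hc)
  exact hcP

theorem mul_diagInv_pow_mul_apply_zero_zero (μ : ℝˣ) (n : ℕ) {g h : GL (Fin 2) ℝ}
    (hg : g 0 0 ≠ 0) (hh : h 0 0 ≠ 0) :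
    (g * diagInv ℝ μ ^ n * h) 0 0 =
      g 0 0 * μ ^ n * h 0 0 * (1 + g 0 1 * h 1 0 / (g 0 0 * h 0 0) * ((μ : ℝ) ^ 2)⁻¹ ^ n) := by
  have hmul : (g * diagInv ℝ μ ^ n * h) 0 0 =
      g 0 0 * μ ^ n * h 0 0 + g 0 1 * ((μ : ℝ) ^ n)⁻¹ * h 1 0 := by
    simp [← map_pow, coe_diagInv, Matrix.mul_apply]
  have hpow : ((μ : ℝ) ^ 2)⁻¹ ^ n * μ ^ n = ((μ : ℝ) ^ n)⁻¹ := by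
    rw [inv_pow, ← pow_mul, pow_mul', sq]
    field_simp
  rw [hmul, ← hpow]
  field_simp

theorem Intertwines.eventually_exists_mem_axisPairs (hF : Intertwines F l₁ l₂)
    (hx₁ : l₁ x = diagInv ℝ μ) (hx₂ : l₂ x = diagInv ℝ ν) (hμ : 1 < |(μ : ℝ)|)
    (hν : 1 < |(ν : ℝ)|) {y z : Γ} (hy : l₁ y 0 0 ≠ 0) (hz : l₁ z 0 0 ≠ 0) :
    ∀ᶠ n : ℕ in atTop, ∃ p ∈ axisPairs F,
      p.1.1 = 1 + l₁ y 0 1 * l₁ z 1 0 / (l₁ y 0 0 * l₁ z 0 0) * ((μ : ℝ) ^ 2)⁻¹ ^ n ∧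
      p.2.1 = 1 + l₂ y 0 1 * l₂ z 1 0 / (l₂ y 0 0 * l₂ z 0 0) * ((ν : ℝ) ^ 2)⁻¹ ^ n := by
  have hpair {γ : Γ} (hγ : l₁ γ 0 0 ≠ 0) :
      ∃ c : ℝˣ, l₂ γ 0 0 = c ∧ (Units.mk0 _ hγ, c) ∈ axisPairs F :=
    hF.exists_mem_axisPairs hx₁ hx₂ hμ hν rfl
  have hpow (n : ℕ) : (μ ^ n, ν ^ n) ∈ axisPairs F :=
    pow_mem (hF.mk_mem_axisPairs hx₁ hx₂ hμ hν) n
  obtain ⟨a, ha, haP⟩ := hpair hy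
  obtain ⟨b, hb, hbP⟩ := hpair hz
  filter_upwards [eventually_one_add_mul_inv_sq_pow_pos hμ
    (l₁ y 0 1 * l₁ z 1 0 / (l₁ y 0 0 * l₁ z 0 0))] with n hn
  have hyz₁ := mul_diagInv_pow_mul_apply_zero_zero μ n hy hz
  have hyz₂ := mul_diagInv_pow_mul_apply_zero_zero ν n (ha ▸ a.ne_zero) (hb ▸ b.ne_zero)
  rw [← hx₁, ← map_pow, ← map_mul, ← map_mul] at hyz₁
  rw [← hx₂, ← map_pow, ← map_mul, ← map_mul] at hyz₂
  have hμn : (μ : ℝ) ^ n ≠ 0 := pow_ne_zero n μ.ne_zero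
  have hνn : (ν : ℝ) ^ n ≠ 0 := pow_ne_zero n ν.ne_zero
  obtain ⟨c, hc, hcP⟩ := hpair (γ := y * x ^ n * z)
    (hyz₁ ▸ mul_ne_zero (mul_ne_zero (mul_ne_zero hy hμn) hz) hn.ne')
  refine ⟨_, div_mem hcP (mul_mem (mul_mem haP (hpow n)) hbP), ?_, ?_⟩
  · simp only [Prod.fst_div, Prod.fst_mul, Units.val_div_eq_div_val, Units.val_mul,
      Units.val_pow_eq_pow_val, Units.val_mk0]
    rw [hyz₁, mul_div_cancel_left₀ _ (mul_ne_zero (mul_ne_zero hy hμn) hz)]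
  · simp only [Prod.snd_div, Prod.snd_mul, Units.val_div_eq_div_val, Units.val_mul,
      Units.val_pow_eq_pow_val]
    rw [← hc, hyz₂, ha, hb,
      mul_div_cancel_left₀ _ (mul_ne_zero (mul_ne_zero a.ne_zero hνn) b.ne_zero)]

theorem Intertwines.apply_zero_zero_eq (hF : Intertwines F l₁ l₂) (hx₁ : l₁ x = diagInv ℝ μ)
    (hx₂ : l₂ x = diagInv ℝ ν) (hμ : 1 < |(μ : ℝ)|) (hν : 1 < |(ν : ℝ)|) {y z : Γ}
    (hy₀ : l₁ y 0 0 ≠ 0) (hy₁ : l₁ y 0 1 ≠ 0) (hz₀ : l₁ z 0 0 ≠ 0) (hz₁ : l₁ z 1 0 ≠ 0) (γ : Γ) :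
    l₁ γ 0 0 = l₂ γ 0 0 := by
  have hdiag {p : ℝˣ × ℝˣ} (hp : p ∈ axisPairs F) : p.1 = p.2 :=
    fst_eq_snd_of_mem (isClosed_axisPairs F) (fun _ ↦ eq_one_of_mk_one_mem_axisPairs)
      (fun _ ↦ eq_one_of_one_mk_mem_axisPairs) hμ hν
      (hF.mk_mem_axisPairs hx₁ hx₂ hμ hν)
      (div_ne_zero (mul_ne_zero hy₁ hz₁) (mul_ne_zero hy₀ hz₀))
      (hF.eventually_exists_mem_axisPairs hx₁ hx₂ hμ hν hy₀ hz₀) hp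
  rcases eq_or_ne (l₁ γ 0 0) 0 with hγ | hγ
  · by_contra hne
    obtain ⟨c, hc, -⟩ := hF.symm.exists_mem_axisPairs hx₂ hx₁ hν hμ (γ := γ)
      (s := Units.mk0 _ fun h ↦ hne (hγ.trans h.symm)) rfl
    exact c.ne_zero (hc ▸ hγ)
  · obtain ⟨c, hc, hcP⟩ := hF.exists_mem_axisPairs hx₁ hx₂ hμ hν (γ := γ) (s := Units.mk0 _ hγ) rfl
    exact (congrArg Units.val (hdiag hcP)).trans hc.symm

end Axis

section InvariantForm

variable {R : Type*} [CommRing R] (A : Matrix (Fin 2) (Fin 2) R) (p : Fin 2 → R)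

/-- The quadratic form `p ↦ det (p, A p)`, which `A` preserves when `det A = 1`. -/
def invariantForm : R :=
  A 1 0 * p 0 ^ 2 + (A 1 1 - A 0 0) * (p 0 * p 1) - A 0 1 * p 1 ^ 2

theorem invariantForm_mulVec : invariantForm A (A.mulVec p) = A.det * invariantForm A p := by
  simp only [invariantForm, Matrix.det_fin_two, Matrix.mulVec_fin_two, Matrix.cons_val_zero,
    Matrix.cons_val_one]
  ring

theorem four_mul_apply_one_zero_mul_invariantForm :
    4 * A 1 0 * invariantForm A p =
      (2 * A 1 0 * p 0 + (A 1 1 - A 0 0) * p 1) ^ 2 - A.discr * p 1 ^ 2 := by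
  rw [invariantForm, Matrix.discr_fin_two, Matrix.trace_fin_two, Matrix.det_fin_two]
  ring

theorem neg_four_mul_apply_zero_one_mul_invariantForm :
    -4 * A 0 1 * invariantForm A p =
      (2 * A 0 1 * p 1 - (A 1 1 - A 0 0) * p 0) ^ 2 - A.discr * p 0 ^ 2 := by
  rw [invariantForm, Matrix.discr_fin_two, Matrix.trace_fin_two, Matrix.det_fin_two]
  ring

end InvariantForm

theorem isCompact_setOf_invariantForm_eq {A : Matrix (Fin 2) (Fin 2) ℝ} (hA : A.IsElliptic)
    (c : ℝ) : IsCompact {p | invariantForm A p = c} := by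
  have hdiscr : 0 < -A.discr := neg_pos.2 hA
  refine (isCompact_univ_pi fun i ↦ isCompact_Icc
    (a := -√(![-4 * A 0 1 * c, 4 * A 1 0 * c] i / -A.discr))
    (b := √(![-4 * A 0 1 * c, 4 * A 1 0 * c] i / -A.discr))).of_isClosed_subset
    (isClosed_eq (by unfold invariantForm; fun_prop) continuous_const) ?_
  rintro p rfl i -
  refine abs_le.1 (Real.abs_le_sqrt ((le_div_iff₀ hdiscr).2 ?_))
  fin_cases i
  · change p 0 ^ 2 * -A.discr ≤ -4 * A 0 1 * invariantForm A p
    rw [neg_four_mul_apply_zero_one_mul_invariantForm]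
    linarith [sq_nonneg (2 * A 0 1 * p 1 - (A 1 1 - A 0 0) * p 0)]
  · change p 1 ^ 2 * -A.discr ≤ 4 * A 1 0 * invariantForm A p
    rw [four_mul_apply_one_zero_mul_invariantForm]
    linarith [sq_nonneg (2 * A 1 0 * p 0 + (A 1 1 - A 0 0) * p 1)]

/-- Some forward orbit of `g` stays in a compact set. On the punctured plane this topological
property singles out the matrices of determinant one that are not hyperbolic. -/
def HasPrecompactOrbit {G : Type*} (α : Type*) [Group G] [TopologicalSpace α] [MulAction G α]
    (g : G) : Prop :=
  ∃ (a : α) (K : Set α), IsCompact K ∧ ∀ n : ℕ, g ^ n • a ∈ K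

section HasPrecompactOrbit

variable {G H α β : Type*} [Group G] [Group H] [TopologicalSpace α] [TopologicalSpace β]
  [MulAction G α] [MulAction H β] {g : G}

theorem HasPrecompactOrbit.of_semiconj {h : H} {f : α → β} (hg : HasPrecompactOrbit α g)
    (hf : Continuous f) (hfg : ∀ a, f (g • a) = h • f a) : HasPrecompactOrbit β h := by
  obtain ⟨a, K, hK, ha⟩ := hg
  refine ⟨f a, f '' K, hK.image hf, fun n ↦ ⟨g ^ n • a, ha n, ?_⟩⟩
  exact pow_mem (S := semiconjPairs G H f) (x := (g, h)) hfg n a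

theorem hasPrecompactOrbit_of_pow_smul_eq {a : α} {n : ℕ} (hn : 0 < n) (ha : g ^ n • a = a) :
    HasPrecompactOrbit α g := by
  refine ⟨a, _, ((Set.finite_Iio (MulAction.period g a)).image fun k ↦ g ^ k • a).isCompact,
    fun k ↦ ⟨k % MulAction.period g a, Nat.mod_lt k ?_, MulAction.pow_mod_period_smul k⟩⟩
  exact Nat.pos_of_dvd_of_pos (MulAction.pow_smul_eq_iff_period_dvd.1 ha) hn

end HasPrecompactOrbit

section PuncturedPlaneOrbits

variable {g : GL (Fin 2) ℝ}

theorem hasPrecompactOrbit_of_isElliptic (hg : g.IsElliptic) (hdet : g.val.det = 1) :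
    HasPrecompactOrbit PuncturedPlane g := by
  have hinv (p : Fin 2 → ℝ) (n : ℕ) : invariantForm g (g ^ n • p) = invariantForm g p := by
    induction n with
    | zero => simp
    | succ n ih =>
      rw [pow_succ', mul_smul, ← ih]
      exact (invariantForm_mulVec _ _).trans (by rw [hdet, one_mul])
  refine ⟨axisPoint, Subtype.val ⁻¹' {p | invariantForm g p = invariantForm g axisPoint.1}, ?_,
    hinv axisPoint.1⟩
  rw [Subtype.isCompact_iff, Set.image_preimage_eq_of_subset]
  · exact isCompact_setOf_invariantForm_eq hg _
  · refine fun p hp ↦ ⟨⟨p, ?_⟩, rfl⟩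
    rintro rfl
    have : g 1 0 ≠ 0 := hg.c_ne_zero
    simp [invariantForm, axisPoint, this.symm] at hp

theorem hasPrecompactOrbit_of_discr_eq_zero (hg : g.val.discr = 0) (hdet : g.val.det = 1) :
    HasPrecompactOrbit PuncturedPlane g := by
  have htrace : (g.val.trace / 2) ^ 2 = 1 := by
    rw [Matrix.discr_fin_two, hdet] at hg
    linarith
  have hker : (g.val - Matrix.scalar (Fin 2) (g.val.trace / 2)).det = 0 := by
    have := congrArg Matrix.det (Matrix.sub_scalar_sq_eq_discr (m := g.val))
    simpa [hg] using this
  obtain ⟨v, hv, hgv⟩ := Matrix.exists_mulVec_eq_zero_iff.2 hker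
  have hgv' : g • v = (g.val.trace / 2) • v := by
    rw [Matrix.sub_mulVec, sub_eq_zero] at hgv
    simpa using hgv
  refine hasPrecompactOrbit_of_pow_smul_eq (a := ⟨v, hv⟩) two_pos (Subtype.ext ?_)
  change g ^ 2 • v = v
  rw [sq, mul_smul, hgv', smul_comm, hgv', smul_smul, ← sq, htrace, one_smul]

theorem not_hasPrecompactOrbit_diagInv {r : ℝˣ} (hr : 1 < |(r : ℝ)|) :
    ¬ HasPrecompactOrbit PuncturedPlane (diagInv ℝ r) := by
  rintro ⟨p, K, hK, hp⟩
  have hK' : IsCompact (Subtype.val '' K) := hK.image continuous_subtype_val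
  have hp' (n : ℕ) : ![(r : ℝ) ^ n * p.1 0, (r ^ n)⁻¹.1 * p.1 1] ∈ Subtype.val '' K :=
    ⟨_, hp n, by ext i; fin_cases i <;> simp [← map_pow, coe_diagInv]⟩
  rcases eq_or_ne (p.1 0) 0 with hp₀ | hp₀
  · have hlim : Tendsto (fun n : ℕ ↦ ![(r : ℝ) ^ n * p.1 0, (r ^ n)⁻¹.1 * p.1 1]) atTop (𝓝 0) := by
      refine tendsto_pi_nhds.2 (Fin.forall_fin_two.2 ⟨?_, ?_⟩)
      · simp [hp₀]
      · simpa using (tendsto_inv_pow_nhds_zero hr).mul_const (p.1 1)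
    obtain ⟨q, -, hq⟩ := hK'.isClosed.mem_of_tendsto hlim (.of_forall hp')
    exact q.2 hq
  · obtain ⟨C, hC⟩ := hK'.isBounded.exists_norm_le
    obtain ⟨n, hn⟩ := pow_unbounded_of_one_lt (C / |p.1 0|) hr
    rw [div_lt_iff₀ (abs_pos.2 hp₀), ← abs_pow, ← abs_mul] at hn
    exact hn.not_ge ((norm_le_pi_norm _ 0).trans (hC _ (hp' n)))

end PuncturedPlaneOrbits

theorem isHyperbolic_iff_not_hasPrecompactOrbit {g : GL (Fin 2) ℝ} (hdet : g.val.det = 1) :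
    g.IsHyperbolic ↔ ¬ HasPrecompactOrbit PuncturedPlane g := by
  refine ⟨fun hg horb ↦ ?_, fun horb ↦ ?_⟩
  · obtain ⟨P, r, hr, hP⟩ := exists_conj_eq_diagInv hg hdet
    refine not_hasPrecompactOrbit_diagInv hr (horb.of_semiconj (continuous_const_smul P) fun p ↦ ?_)
    rw [← hP, mul_smul, inv_smul_smul, mul_smul]
  · rcases lt_trichotomy g.val.discr 0 with hell | hpar | hhyp
    · exact absurd (hasPrecompactOrbit_of_isElliptic hell hdet) horb
    · exact absurd (hasPrecompactOrbit_of_discr_eq_zero hpar hdet) horb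
    · exact hhyp

section Intertwines

variable {Γ : Type*} [Group Γ] {F : PuncturedPlane ≃ₜ PuncturedPlane} {l₁ l₂ : Γ →* GL (Fin 2) ℝ}

theorem Intertwines.isHyperbolic (hF : Intertwines F l₁ l₂) {x : Γ} (hdet₁ : (l₁ x).val.det = 1)
    (hdet₂ : (l₂ x).val.det = 1) (hx : (l₁ x).IsHyperbolic) : (l₂ x).IsHyperbolic := by
  rw [isHyperbolic_iff_not_hasPrecompactOrbit hdet₁] at hx
  rw [isHyperbolic_iff_not_hasPrecompactOrbit hdet₂]
  exact fun horb ↦ hx (horb.of_semiconj F.symm.continuous (hF.symm x))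

theorem Intertwines.conj (hF : Intertwines F l₁ l₂) (P Q : GL (Fin 2) ℝ) :
    Intertwines (((Homeomorph.smul P⁻¹).trans F).trans (Homeomorph.smul Q))
      ((MulAut.conj P).toMonoidHom.comp l₁) ((MulAut.conj Q).toMonoidHom.comp l₂) := by
  intro γ p
  simp [mul_smul, hF _ _]

theorem Intertwines.conjugateReps (hF : Intertwines F l₁ l₂) (hl₁ : ¬ Group.IsSolvable l₁.range) :
    ConjugateReps l₁ l₂ := by
  have hcomm : ¬ Group.IsSolvable ((commutator Γ).map l₁) := by
    rw [map_commutator_eq]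
    exact mt isSolvable_of_isSolvable_bracket hl₁
  obtain ⟨_, ⟨x, hx, rfl⟩, hhyp⟩ := exists_isHyperbolic hcomm
    (Set.forall_mem_image.2 fun x hx ↦ det_eq_one_of_mem_commutator l₁ hx)
  have hdet₁ := det_eq_one_of_mem_commutator l₁ hx
  have hdet₂ := det_eq_one_of_mem_commutator l₂ hx
  obtain ⟨P, μ, hμ, hP⟩ := exists_conj_eq_diagInv hhyp hdet₁
  obtain ⟨Q, ν, hν, hQ⟩ := exists_conj_eq_diagInv (hF.isHyperbolic hdet₁ hdet₂ hhyp) hdet₂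
  have hP_range : ¬ Group.IsSolvable ((MulAut.conj P).toMonoidHom.comp l₁).range := by
    rw [MonoidHom.range_comp]
    exact mt (isSolvable_of_isSolvable_map (MulAut.conj P).injective) hl₁
  obtain ⟨_, ⟨y, rfl⟩, hy₀, hy₁⟩ :=
    exists_apply_zero_zero_ne_zero_and_apply_zero_one_ne_zero hP_range
  obtain ⟨_, ⟨z, rfl⟩, hz₀, hz₁⟩ :=
    exists_apply_zero_zero_ne_zero_and_apply_one_zero_ne_zero hP_range
  obtain ⟨k, hk⟩ := exists_conj_of_apply_zero_zero_eq
    ((hF.conj P Q).apply_zero_zero_eq hP hQ hμ hν hy₀ hy₁ hz₀ hz₁) hy₁ hz₁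
  refine ⟨Q⁻¹ * k * P, fun γ ↦ ?_⟩
  have hkγ : Q * l₂ γ * Q⁻¹ = k * (P * l₁ γ * P⁻¹) * k⁻¹ := hk γ
  rw [mul_inv_eq_iff_eq_mul, ← eq_inv_mul_iff_mul_eq] at hkγ
  rw [hkγ]
  group

end Intertwines

section Annulus

theorem mk_eq_ptE2_iff {v : V} (hv : v ≠ 0) :
    Projectivization.mk ℝ v hv = ptE2 ↔ v 0 = 0 ∧ v 2 = 0 := by
  rw [ptE2, Projectivization.mk_eq_mk_iff']
  refine ⟨?_, fun h ↦ ⟨v 1, ?_⟩⟩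
  · rintro ⟨a, rfl⟩
    simp
  · ext i
    fin_cases i <;> simp [h]

theorem mk_mem_annulus {v : V} (hv : v ≠ 0) :
    Projectivization.mk ℝ v hv ∈ annulus ↔ v 1 ≠ 0 ∧ ¬ (v 0 = 0 ∧ v 2 = 0) := by
  rw [annulus, Set.mem_compl_iff, Set.mem_union, mk_mem_lineL0, Set.mem_singleton_iff,
    mk_eq_ptE2_iff, not_or]

/-- The affine coordinates `(v₀ / v₁, v₂ / v₁)` on `P(V) ∖ L₀`, with the junk value `0` on
`L₀`. -/
noncomputable def affineCoord : ℙ ℝ V → Fin 2 → ℝ :=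
  Projectivization.lift (fun v ↦ ![v.1 0 / v.1 1, v.1 2 / v.1 1]) <| by
    rintro ⟨_, hv⟩ ⟨w, hw⟩ t rfl
    have ht : t ≠ 0 := fun ht ↦ hv (by simp [ht])
    simp [mul_div_mul_left _ _ ht]

theorem affineCoord_mk {v : V} (hv : v ≠ 0) :
    affineCoord (Projectivization.mk ℝ v hv) = ![v 0 / v 1, v 2 / v 1] := rfl

theorem affineCoord_ne_zero {p : ℙ ℝ V} (hp : p ∈ annulus) : affineCoord p ≠ 0 := by
  induction p with
  | h v hv =>
    obtain ⟨hv₁, hv₀₂⟩ := (mk_mem_annulus hv).1 hp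
    refine fun h ↦ hv₀₂ ⟨?_, ?_⟩
    · exact (div_eq_zero_iff.1 (congrFun h 0)).resolve_right hv₁
    · exact (div_eq_zero_iff.1 (congrFun h 1)).resolve_right hv₁

theorem affineCoord_smul (g : GL (Fin 2) ℝ) (p : ℙ ℝ V) :
    affineCoord (embGL g • p) = g • affineCoord p := by
  induction p with
  | h v hv =>
    rw [Projectivization.smul_mk, affineCoord_mk, affineCoord_mk, embGL_smul]
    ext i
    fin_cases i <;> simp <;> ring

theorem isQuotientMap_mk' :
    IsQuotientMap (Projectivization.mk' ℝ : {v : V // v ≠ 0} → ℙ ℝ V) :=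
  ⟨⟨rfl⟩, Quotient.mk_surjective⟩

theorem continuous_coord (i : Fin 3) : Continuous fun v : {v : V // v ≠ 0} ↦ v.1 i :=
  (continuous_apply i).comp continuous_subtype_val

theorem preimage_mk'_compl_lineL0 :
    Projectivization.mk' ℝ ⁻¹' lineL0ᶜ = {v : {v : V // v ≠ 0} | v.1 1 ≠ 0} :=
  Set.ext fun v ↦ not_congr (mk_mem_lineL0 v.2)

theorem isOpen_compl_lineL0 : IsOpen lineL0ᶜ := by
  rw [← isQuotientMap_mk'.isOpen_preimage, preimage_mk'_compl_lineL0]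
  exact isOpen_ne_fun (continuous_coord 1) continuous_const

theorem continuousOn_affineCoord : ContinuousOn affineCoord lineL0ᶜ := by
  rw [isQuotientMap_mk'.continuousOn_isOpen_iff isOpen_compl_lineL0, preimage_mk'_compl_lineL0]
  refine continuousOn_pi.2 (Fin.forall_fin_two.2 ⟨?_, ?_⟩)
  · exact (continuous_coord 0).continuousOn.div (continuous_coord 1).continuousOn fun _ ↦ id
  · exact (continuous_coord 2).continuousOn.div (continuous_coord 1).continuousOn fun _ ↦ id

theorem mk_mem_annulus_of_ne_zero {p : Fin 2 → ℝ} (hp : p ≠ 0) :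
    Projectivization.mk ℝ (![p 0, 1, p 1] : V) (fun h ↦ one_ne_zero (congrFun h 1)) ∈ annulus :=
  (mk_mem_annulus _).2 ⟨one_ne_zero, fun h ↦ hp (funext (Fin.forall_fin_two.2 h))⟩

/-- The identification of the annulus with the punctured plane by affine coordinates. -/
noncomputable def annulusHomeomorph : annulus ≃ₜ PuncturedPlane where
  toFun p := ⟨affineCoord p, affineCoord_ne_zero p.2⟩
  invFun p := ⟨_, mk_mem_annulus_of_ne_zero p.2⟩
  left_inv := by
    rintro ⟨p, hp⟩
    induction p with
    | h v hv =>
      obtain ⟨hv₁, -⟩ := (mk_mem_annulus hv).1 hp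
      refine Subtype.ext ((Projectivization.mk_eq_mk_iff' _ _ _ _ _).2 ⟨(v 1)⁻¹, ?_⟩)
      ext i
      fin_cases i <;> simp [affineCoord_mk, hv₁, div_eq_inv_mul]
  right_inv p := by
    ext i
    fin_cases i <;> simp [affineCoord_mk]
  continuous_toFun := by
    refine (ContinuousOn.comp_continuous continuousOn_affineCoord continuous_subtype_val
      fun p ↦ ?_).subtype_mk _
    exact fun h ↦ p.2 (Or.inl h)
  continuous_invFun := by
    refine (isQuotientMap_mk'.continuous.comp (Continuous.subtype_mk ?_ _)).subtype_mk _
    refine continuous_pi fun i ↦ ?_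
    fin_cases i
    · exact (continuous_apply (0 : Fin 2)).comp (continuous_subtype_val (p := (· ≠ 0)))
    · exact continuous_const
    · exact (continuous_apply (1 : Fin 2)).comp (continuous_subtype_val (p := (· ≠ 0)))

theorem annulusHomeomorph_smul (g : GL (Fin 2) ℝ) (p : annulus) :
    annulusHomeomorph (g • p) = g • annulusHomeomorph p :=
  Subtype.ext (affineCoord_smul g p)

theorem annulusHomeomorph_symm_smul (g : GL (Fin 2) ℝ) (p : PuncturedPlane) :
    annulusHomeomorph.symm (g • p) = g • annulusHomeomorph.symm p := by
  rw [Homeomorph.symm_apply_eq, annulusHomeomorph_smul, Homeomorph.apply_symm_apply]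

end Annulus

section Main

theorem exists_surjective_genusGroup_perm {g : ℕ} (hg : 2 ≤ g) :
    ∃ f : GenusGroup g →* Equiv.Perm (Fin 5), Function.Surjective f := by
  let φ : Fin g ⊕ Fin g → Equiv.Perm (Fin 5) := Sum.elim
    (fun i ↦ if i = ⟨0, by omega⟩ then finRotate 5 else Equiv.swap 0 1) (fun _ ↦ 1)
  have hφ : ∀ r ∈ ({surfaceRelator g} : Set (FreeGroup (Fin g ⊕ Fin g))),
      FreeGroup.lift φ r = 1 := by
    rintro r rfl
    simp [surfaceRelator, map_list_prod, List.map_ofFn, Function.comp_def, φ]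
  refine ⟨PresentedGroup.toGroup hφ, ?_⟩
  rw [← MonoidHom.range_eq_top, eq_top_iff,
    ← Equiv.Perm.closure_prime_cycle_swap (σ := finRotate 5) (τ := Equiv.swap 0 1)
      (by simpa using Nat.prime_five) isCycle_finRotate support_finRotate ⟨0, 1, by decide, rfl⟩,
    Subgroup.closure_le]
  rintro x (rfl | rfl)
  · exact ⟨PresentedGroup.of (Sum.inl ⟨0, by omega⟩), by simp [φ]⟩
  · exact ⟨PresentedGroup.of (Sum.inl ⟨1, by omega⟩), by simp [φ]⟩

theorem IsSurfaceGroup.not_isSolvable {Γ : Type*} [Group Γ] (hΓ : IsSurfaceGroup Γ) :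
    ¬ Group.IsSolvable Γ := by
  obtain ⟨g, hg, ⟨e⟩⟩ := hΓ
  obtain ⟨f, hf⟩ := exists_surjective_genusGroup_perm hg
  intro hsolv
  exact Equiv.Perm.not_isSolvable_fin_5
    (Group.isSolvable_of_surjective (f := f.comp e.toMonoidHom) (hf.comp e.surjective))

variable {Γ : Type*} [Group Γ] {l₁ l₂ : Γ →* GL (Fin 2) ℝ}

theorem conjugateActions_iff_exists_intertwines :
    ConjugateActions l₁ l₂ ↔ ∃ F, Intertwines F l₁ l₂ := by
  constructor
  · rintro ⟨f, hf⟩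
    refine ⟨(annulusHomeomorph.symm.trans f).trans annulusHomeomorph, fun γ p ↦ ?_⟩
    simp [annulusHomeomorph_symm_smul, hf, annulusHomeomorph_smul]
  · rintro ⟨F, hF⟩
    refine ⟨(annulusHomeomorph.trans F).trans annulusHomeomorph.symm, fun γ p ↦ ?_⟩
    simp [annulusHomeomorph_symm_smul, hF _ _, annulusHomeomorph_smul]

theorem ConjugateReps.exists_intertwines (h : ConjugateReps l₁ l₂) :
    ∃ F, Intertwines F l₁ l₂ := by
  obtain ⟨g, hg⟩ := h
  refine ⟨Homeomorph.smul g, fun γ p ↦ ?_⟩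
  simp [hg, mul_smul]

end Main

end SurfaceRigidity

theorem mainTheorem11_general {Γ : Type*} [Group Γ] {l₁ l₂ : Γ →* GL (Fin 2) ℝ}
    (hl₁ : ¬ Group.IsSolvable l₁.range) :
    SurfaceRigidity.ConjugateActions l₁ l₂ ↔ SurfaceRigidity.ConjugateReps l₁ l₂ := by
  rw [SurfaceRigidity.conjugateActions_iff_exists_intertwines]
  exact ⟨fun ⟨_, hF⟩ ↦ hF.conjugateReps hl₁, fun h ↦ h.exists_intertwines⟩

theorem mainTheorem11 {Γ : Type*} [Group Γ] (hΓ : SurfaceRigidity.IsSurfaceGroup Γ)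
    (l₁ l₂ : Γ →* GL (Fin 2) ℝ)
    (h₁ : SurfaceRigidity.IsDiscreteFaithful l₁) (h₂ : SurfaceRigidity.IsDiscreteFaithful l₂) :
    SurfaceRigidity.ConjugateActions l₁ l₂ ↔ SurfaceRigidity.ConjugateReps l₁ l₂ :=
  mainTheorem11_general fun _ ↦ hΓ.not_isSolvable <|
    Group.isSolvable_of_isSolvable_injective (MonoidHom.rangeRestrict_injective_iff.2 h₁.1)
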